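/- Let $\mathrm{Homeo}_0(\mathbb R)$ be the group of orientation-preserving homeomorphisms of $\mathbb R$ with the compact-open topology, let $G$ be a countable group, and give $\mathrm{Hom}(G,\mathrm{Homeo}_0(\mathbb R))$ the topology induced by the product topology on $\mathrm{Homeo}_0(\mathbb R)^G$. For $f\in\mathrm{Homeo}_0(\mathbb R)$ and an action $\varphi\in \mathrm{Hom}(G,\mathrm{Homeo}_0(\mathbb R))$ put $(f.\varphi)(g)=f\circ\varphi(g)\circ f^{-1}$. An action is irreducible if it has no global fixed point, minimal if all its orbits are dense in $\mathbb R$, and cyclic if it is irreducible and factors through a morphism $G\to\mathbb Z$; let $\mathrm{Rep}_{\mathrm{irr}}(G)$ and $\mathrm{Rep}_{\mathrm{min}}(G)$ be the spaces of irreducible and of minimal actions. Let $\mathrm{Rep}_{\mathrm{III}}(G)$ be the set of minimal actions $\varphi$ of type III, i.e. that are proximal: for all $x,y\in\mathbb R$ there are $z\in\mathbb R$ and a sequence $(g_n)$ in $G$ with $\lim_n\varphi(g_n).x=\lim_n\varphi(g_n).y=z$. The class $\mathcal C$ consists of the countable groups $G$ for which conjugacy on $\mathrm{Rep}_{\mathrm{min}}(G)$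 is smooth, i.e. for which there is a Borel map $e\colon\mathrm{Rep}_{\mathrm{min}}(G)\to\mathbb R$ such that $e(\varphi)=e(\psi)$ if and only if $\psi=f.\varphi$ for some $f\in\mathrm{Homeo}_0(\mathbb R)$. A sequence $(f_n)_{n\ge 0}$ in $\mathrm{Homeo}_0(\mathbb R)$ almost centralizes $\varphi$ if $\lim_n f_n.\varphi=\varphi$. **Theorem.** For a countable group $G$ the following are equivalent: 1. $G\in\mathcal C$; 2. for every $\varphi\in\mathrm{Rep}_{\mathrm{III}}(G)$, every sequence $(f_n)_{n\ge0}$ almost centralizing $\varphi$ tends to $\mathrm{id}_{\mathbb R}$; 3. for every $\varphi\in\mathrm{Rep}_{\mathrm{III}}(G)$ and every sequence $(f_n)_{n\ge0}$ almost centralizing $\varphi$, there exists $z\in\mathbb R$ such that $(f_n^{-1}(z))_{n\ge0}$ is bounded. If $G$ is finitely generated and $\mathrm{Harm}(G)$ is any space of harmonic actions of $G$ (defined below), then these conditions are also equivalent to: 4. for every $\varphi\in\mathrm{Rep}_{\mathrm{III}}(G)\cap\mathrm{Harm}(G)$ and every sequence $(t_n)_{n\ge0}$ in $\mathbb R$ with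 $\lim_n\Psi^{t_n}(\varphi)=\varphi$, one has $\lim_n t_n=0$. Here $\Psi^t(\varphi)=T_t.\varphi$, where $T_t(s)=s+t$. A semiconjugacy from $\varphi_1$ to $\varphi_2$ is a non-decreasing map $h\colon\mathbb R\to\mathbb R$ with $h\circ\varphi_1(g)=\varphi_2(g)\circ h$ for all $g\in G$. Two irreducible actions $\varphi_1,\varphi_2$ are pointed semiconjugate if there are a minimal or cyclic action $\eta$ and semiconjugacies $h_i$ from $\varphi_i$ to $\eta$ ($i=1,2$) with $h_1(0)=h_2(0)$. A space of harmonic actions of $G$ is a compact $\Psi$-invariant subspace $\mathrm{Harm}(G)\subseteq\mathrm{Rep}_{\mathrm{irr}}(G)$ composed of minimal and cyclic actions for which there is a continuous retraction $r\colon\mathrm{Rep}_{\mathrm{irr}}(G)\to\mathrm{Harm}(G)$ such that $r(\varphi_1)=r(\varphi_2)$ if and only if $\varphi_1$ and $\varphi_2$ are pointed semiconjugate. -/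

import Mathlib

open Filter Topology

namespace LineAction

/-- `Homeo₀(ℝ)`: the group of orientation-preserving (that is, increasing) homeomorphisms of the
real line, under composition: `(f * g) x = f (g x)`. -/
def homeo0 : Subgroup (ℝ ≃ₜ ℝ) where
  carrier := {f | StrictMono f}
  mul_mem' {f g} hf hg := by
    intro x y hxy
    exact hf (hg hxy)
  one_mem' := by
    intro x y hxy
    exact hxy
  inv_mem' {f} hf := by
    intro x y hxy
    have key : ∀ z : ℝ, f ((f⁻¹ : ℝ ≃ₜ ℝ) z) = z := fun z => f.apply_symm_apply z
    have h : f ((f⁻¹ : ℝ ≃ₜ ℝ) x) < f ((f⁻¹ : ℝ ≃ₜ ℝ) y) := by rw [key, key]; exact hxy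
    exact hf.lt_iff_lt.mp h

/-- The type of orientation-preserving homeomorphisms of the line. -/
abbrev Homeo0 : Type := ↥homeo0

instance : CoeFun Homeo0 (fun _ => ℝ → ℝ) := ⟨fun f => (f : ℝ ≃ₜ ℝ)⟩

/-- The underlying continuous map of an element of `Homeo₀(ℝ)`. -/
def toC (f : Homeo0) : C(ℝ, ℝ) := ⟨f, (f : ℝ ≃ₜ ℝ).continuous⟩

/-- The compact-open topology on `Homeo₀(ℝ)`. -/
instance : TopologicalSpace Homeo0 := TopologicalSpace.induced toC inferInstance

/-- The space `Hom(G, Homeo₀(ℝ))` of actions of `G` on the line. -/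
abbrev Act (G : Type*) [Group G] := G →* Homeo0

/-- The topology on `Hom(G, Homeo₀(ℝ))` induced from the product topology on `Homeo₀(ℝ) ^ G`. -/
instance (G : Type*) [Group G] : TopologicalSpace (Act G) :=
  TopologicalSpace.induced (fun φ => (φ : G → Homeo0)) inferInstance

/-- The action of `Homeo₀(ℝ)` on actions by conjugation: `(f.φ)(g) = f ∘ φ(g) ∘ f⁻¹`. -/
def conj {G : Type*} [Group G] (f : Homeo0) (φ : Act G) : Act G :=
  (MulAut.conj f).toMonoidHom.comp φ

/-- `Rep_irr(G)`: the actions without global fixed points. -/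
def repIrr (G : Type*) [Group G] : Set (Act G) :=
  {φ | ¬ ∃ x : ℝ, ∀ g : G, φ g x = x}

/-- `Rep_min(G)`: the minimal actions, that is, those all of whose orbits are dense in `ℝ`. -/
def repMin (G : Type*) [Group G] : Set (Act G) :=
  {φ | ∀ x : ℝ, Dense (Set.range fun g : G => φ g x)}

/-- `Rep_cyc(G)`: the irreducible actions that factor through a morphism `G → ℤ`. -/
def repCyc (G : Type*) [Group G] : Set (Act G) :=
  {φ | φ ∈ repIrr G ∧ ∃ (p : G →* Multiplicative ℤ) (ψ : Multiplicative ℤ →* Homeo0),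
    φ = ψ.comp p}

/-- The action `φ` is proximal: any two points `x, y` can be sent by a sequence of group elements
to sequences converging to a common point of the line. -/
def IsProximal {G : Type*} [Group G] (φ : Act G) : Prop :=
  ∀ x y : ℝ, ∃ (z : ℝ) (g : ℕ → G),
    Tendsto (fun n => φ (g n) x) atTop (𝓝 z) ∧ Tendsto (fun n => φ (g n) y) atTop (𝓝 z)

/-- `Rep_III(G)`: the minimal actions of type III, that is, the minimal proximal actions. -/
def repIII (G : Type*) [Group G] : Set (Act G) :=
  {φ | φ ∈ repMin G ∧ IsProximal φ}

/-- The class `𝒞`: countable groups `G` for which the conjugacy relation on `Rep_min(G)` is smooth,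
that is, there is a Borel map `Rep_min(G) → ℝ` whose fibres are exactly the conjugacy classes. -/
def InClassC (G : Type*) [Group G] : Prop :=
  Countable G ∧ ∃ e : repMin G → ℝ, @Measurable _ _ (borel (repMin G)) _ e ∧
    ∀ φ ψ : repMin G, (∃ f : Homeo0, conj f (φ : Act G) = ψ) ↔ e φ = e ψ

/-- The sequence `f` almost centralizes `φ`: `f_n.φ → φ`. -/
def AlmostCentralizes {G : Type*} [Group G] (f : ℕ → Homeo0) (φ : Act G) : Prop :=
  Tendsto (fun n => conj (f n) φ) atTop (𝓝 φ)

/-- The translation `T_t : s ↦ s + t`. -/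
def translation (t : ℝ) : Homeo0 :=
  ⟨Homeomorph.addRight t, fun _ _ h => add_lt_add_left h t⟩

/-- The translation flow `Ψ^t(φ)(g) = T_t ∘ φ(g) ∘ T_{-t}`. -/
def flow {G : Type*} [Group G] (t : ℝ) (φ : Act G) : Act G := conj (translation t) φ

/-- `h` is a semiconjugacy from `φ₁` to `φ₂`; it need not be continuous. -/
def IsSemiconj {G : Type*} [Group G] (h : ℝ → ℝ) (φ₁ φ₂ : Act G) : Prop :=
  Monotone h ∧ ∀ (g : G) (x : ℝ), h (φ₁ g x) = φ₂ g (h x)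

/-- Pointed semiconjugacy of actions. -/
def PointedSemiconj {G : Type*} [Group G] (φ₁ φ₂ : Act G) : Prop :=
  ∃ η ∈ repMin G ∪ repCyc G, ∃ h₁ h₂ : ℝ → ℝ,
    IsSemiconj h₁ φ₁ η ∧ IsSemiconj h₂ φ₂ η ∧ h₁ 0 = h₂ 0

/-- `H` is a space of harmonic actions `Harm(G)`: a compact subspace of `Rep_irr(G)`, invariant
under the translation flow and composed of minimal and cyclic actions, that is a continuous retract
of `Rep_irr(G)` through a retraction whose fibres are the pointed semiconjugacy classes.
(For finitely generated `G` such a space exists, and it is unique up to flow equivalence only.) -/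
structure IsHarmonicSpace (G : Type*) [Group G] (H : Set (Act G)) : Prop where
  subset_irr : H ⊆ repIrr G
  isCompact : IsCompact H
  flow_mem : ∀ (t : ℝ), ∀ φ ∈ H, flow t φ ∈ H
  min_or_cyc : H ⊆ repMin G ∪ repCyc G
  exists_retraction : ∃ r : repIrr G → H, Continuous r ∧
    (∀ φ : repIrr G, (φ : Act G) ∈ H → ((r φ : H) : Act G) = φ) ∧
    ∀ φ₁ φ₂ : repIrr G, r φ₁ = r φ₂ ↔ PointedSemiconj (φ₁ : Act G) (φ₂ : Act G)

end LineAction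

namespace LineAction

/-! ### Evaluation rules for homeomorphisms, actions and conjugates -/

variable {G : Type*} [Group G]

/-! The engine is a compactness principle, `exists_limit_conj`: if `f_i.φ → ψ` with both actions
minimal, the only obstruction to a limit conjugacy is that `f_i⁻¹(z)` escapes to infinity. For
non-proximal `φ` a fixed-point-free centralizer brings `f⁻¹(0)` back to a bounded interval, so the
conjugacy class is closed in `Rep_min`. For type III the centralizer is trivial.

3 → 2: every ultrafilter limit centralizes `φ`, hence is the identity. 2 → 1: conjugators are
bounded near `φ`, so two classes lying in each other's closure coincide. The collection of basic
open sets that a class meets is then a complete Borel invariant. 1 → 3: a class is dense in its own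
closure, so a Borel invariant is generically constant there and one class is comeagre. That class is
a countable union of closed sets with bounded conjugators. By Baire one of them has interior, and
triviality of the centralizer carries the bound over to `f_n`.

For condition 4, the retraction onto the harmonic space turns `f_n.φ` into a flow translate of
`r(φ)` whose time records the position of `f_n⁻¹(0)`. -/

theorem homeo0_strictMono (f : Homeo0) : StrictMono f := f.2

@[simp] theorem homeo0_mul_apply (f g : Homeo0) (x : ℝ) : (f * g) x = f (g x) := rfl

@[simp] theorem homeo0_one_apply (x : ℝ) : (1 : Homeo0) x = x := rfl

@[simp] theorem homeo0_inv_apply_self (f : Homeo0) (x : ℝ) : f⁻¹ (f x) = x :=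
  (f : ℝ ≃ₜ ℝ).symm_apply_apply x

@[simp] theorem homeo0_apply_inv_self (f : Homeo0) (x : ℝ) : f (f⁻¹ x) = x :=
  (f : ℝ ≃ₜ ℝ).apply_symm_apply x

theorem homeo0_ext {f g : Homeo0} (h : ∀ x, f x = g x) : f = g :=
  Subtype.ext (Homeomorph.ext h)

theorem homeo0_continuous (f : Homeo0) : Continuous f := (f : ℝ ≃ₜ ℝ).continuous

theorem homeo0_lt_inv_iff (f : Homeo0) {x y : ℝ} : x < f⁻¹ y ↔ f x < y := by
  rw [← (homeo0_strictMono f).lt_iff_lt, homeo0_apply_inv_self]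

theorem homeo0_inv_lt_iff (f : Homeo0) {x y : ℝ} : f⁻¹ y < x ↔ y < f x := by
  rw [← (homeo0_strictMono f).lt_iff_lt, homeo0_apply_inv_self]

theorem act_mul_apply (φ : Act G) (g h : G) (x : ℝ) : φ (g * h) x = φ g (φ h x) := by
  rw [map_mul]; rfl

theorem act_one_apply (φ : Act G) (x : ℝ) : φ 1 x = x := by
  rw [map_one]; rfl

@[simp] theorem act_inv_apply_self (φ : Act G) (g : G) (x : ℝ) : φ g⁻¹ (φ g x) = x := by
  rw [← act_mul_apply, inv_mul_cancel, act_one_apply]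

@[simp] theorem act_apply_inv_self (φ : Act G) (g : G) (x : ℝ) : φ g (φ g⁻¹ x) = x := by
  rw [← act_mul_apply, mul_inv_cancel, act_one_apply]

theorem conj_apply (f : Homeo0) (φ : Act G) (g : G) (x : ℝ) :
    conj f φ g x = f (φ g (f⁻¹ x)) := rfl

theorem conj_mul (f k : Homeo0) (φ : Act G) : conj (f * k) φ = conj f (conj k φ) := by
  ext1 g
  simp [conj, mul_assoc]

theorem conj_one (φ : Act G) : conj 1 φ = φ := by
  ext1 g
  simp [conj]

theorem conj_eq_iff {f : Homeo0} {φ ψ : Act G} :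
    conj f φ = ψ ↔ ∀ g x, f (φ g x) = ψ g (f x) := by
  constructor
  · rintro rfl g x
    simp [conj_apply]
  · intro h
    ext1 g
    apply homeo0_ext
    intro x
    rw [conj_apply, h, homeo0_apply_inv_self]

theorem conj_inv_eq_iff {f : Homeo0} {φ ψ : Act G} : conj f⁻¹ φ = ψ ↔ φ = conj f ψ := by
  constructor
  · rintro rfl
    rw [← conj_mul, mul_inv_cancel, conj_one]
  · rintro rfl
    rw [← conj_mul, inv_mul_cancel, conj_one]

/-! ### The topologies are those of pointwise convergence -/

theorem tendsto_homeo0_iff {ι : Type*} {l : Filter ι} {F : ι → Homeo0} {f : Homeo0} :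
    Tendsto F l (𝓝 f) ↔ ∀ x, Tendsto (fun i => F i x) l (𝓝 (f x)) := by
  have hind : IsInducing toC := ⟨rfl⟩
  rw [hind.tendsto_nhds_iff]
  constructor
  · intro h x
    exact ((ContinuousEvalConst.continuous_eval_const x).tendsto (toC f)).comp h
  · intro h
    rw [ContinuousMap.tendsto_iff_tendstoLocallyUniformly, Metric.tendstoLocallyUniformly_iff]
    intro ε hε x
    obtain ⟨δ, hδ, hd⟩ := Metric.continuousAt_iff.1 ((homeo0_continuous f).continuousAt (x := x))
      (ε / 4) (by positivity)
    -- Monotonicity traps all values on the interval between those at its two endpoints.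
    refine ⟨Set.Icc (x - δ / 2) (x + δ / 2), Icc_mem_nhds (by linarith) (by linarith), ?_⟩
    have e1 := (Metric.tendsto_nhds.1 (h (x - δ / 2))) (ε / 4) (by positivity)
    have e2 := (Metric.tendsto_nhds.1 (h (x + δ / 2))) (ε / 4) (by positivity)
    have d1 := hd (x := x - δ / 2) (by rw [Real.dist_eq, abs_lt]; constructor <;> linarith)
    have d2 := hd (x := x + δ / 2) (by rw [Real.dist_eq, abs_lt]; constructor <;> linarith)
    filter_upwards [e1, e2] with i h1 h2 y hy
    have m1 := (homeo0_strictMono f).monotone hy.1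
    have m2 := (homeo0_strictMono f).monotone hy.2
    have m3 := (homeo0_strictMono (F i)).monotone hy.1
    have m4 := (homeo0_strictMono (F i)).monotone hy.2
    rw [Real.dist_eq, abs_lt] at *
    change _ < f y - F i y ∧ f y - F i y < _
    constructor <;> linarith [h1.1, h1.2, h2.1, h2.2, d1.1, d1.2, d2.1, d2.2]

theorem tendsto_act_iff {ι : Type*} {l : Filter ι} {Φ : ι → Act G} {φ : Act G} :
    Tendsto Φ l (𝓝 φ) ↔ ∀ g x, Tendsto (fun i => Φ i g x) l (𝓝 (φ g x)) := by
  have hind : IsInducing (fun φ : Act G => (φ : G → Homeo0)) := ⟨rfl⟩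
  rw [hind.tendsto_nhds_iff, tendsto_pi_nhds]
  exact forall_congr' fun g => tendsto_homeo0_iff

theorem tendsto_inv_apply {ι : Type*} {l : Filter ι} {F : ι → Homeo0} {f : Homeo0}
    (h : ∀ x, Tendsto (fun i => F i x) l (𝓝 (f x))) (x : ℝ) :
    Tendsto (fun i => (F i)⁻¹ x) l (𝓝 (f⁻¹ x)) := by
  rw [tendsto_order]
  constructor
  · intro y hy
    rw [homeo0_lt_inv_iff] at hy
    filter_upwards [(h y).eventually_lt_const hy] with i hi
    rwa [homeo0_lt_inv_iff]
  · intro y hy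
    rw [gt_iff_lt, homeo0_inv_lt_iff] at hy
    filter_upwards [(h y).eventually_const_lt hy] with i hi
    rwa [homeo0_inv_lt_iff]

theorem continuous_conj (f : Homeo0) : Continuous (conj f : Act G → Act G) := by
  rw [continuous_iff_continuousAt]
  intro φ
  refine tendsto_act_iff.2 fun g x => ?_
  exact ((homeo0_continuous f).tendsto _).comp (tendsto_act_iff.1 tendsto_id g (f⁻¹ x))

/-- Conjugation by a fixed homeomorphism of the line, as a self-homeomorphism of the space of
actions. -/
def conjHomeomorph (f : Homeo0) : Act G ≃ₜ Act G where
  toFun := conj f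
  invFun := conj f⁻¹
  left_inv φ := by rw [← conj_mul, inv_mul_cancel, conj_one]
  right_inv φ := by rw [← conj_mul, mul_inv_cancel, conj_one]
  continuous_toFun := continuous_conj f
  continuous_invFun := continuous_conj f⁻¹

/-- The family of continuous maps underlying an action. -/
def actToC (φ : Act G) (g : G) : C(ℝ, ℝ) := toC (φ g)

theorem isInducing_actToC : IsInducing (actToC : Act G → G → C(ℝ, ℝ)) := by
  have h1 : IsInducing (fun φ : Act G => (φ : G → Homeo0)) := ⟨rfl⟩
  have h2 : IsInducing (fun (a : G → Homeo0) (g : G) => toC (a g)) :=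
    IsInducing.piMap (f := fun _ : G => toC) fun _ => ⟨rfl⟩
  exact h2.comp h1

/-- Monotonicity and the homomorphism law are closed pointwise conditions. They already characterize
actions, because `a g⁻¹` inverts `a g`. -/
theorem isClosedEmbedding_actToC : IsClosedEmbedding (actToC : Act G → G → C(ℝ, ℝ)) := by
  refine ⟨⟨isInducing_actToC, ?_⟩, ?_⟩
  · intro φ ψ h
    ext1 g
    exact homeo0_ext fun x => DFunLike.congr_fun (congr_fun h g) x
  · have hr : Set.range (actToC : Act G → G → C(ℝ, ℝ)) =
        (⋂ x : ℝ, {a | a 1 x = x}) ∩ (⋂ g : G, ⋂ h : G, ⋂ x : ℝ, {a | a (g * h) x = a g (a h x)}) ∩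
          ⋂ g : G, ⋂ x : ℝ, ⋂ y : ℝ, ⋂ _ : x ≤ y, {a | a g x ≤ a g y} := by
      ext a
      simp only [Set.mem_range, Set.mem_inter_iff, Set.mem_iInter, Set.mem_ofPred_eq]
      constructor
      · rintro ⟨φ, rfl⟩
        refine ⟨⟨act_one_apply φ, act_mul_apply φ⟩, fun g x y h => ?_⟩
        exact (homeo0_strictMono (φ g)).monotone h
      · rintro ⟨⟨h1, h2⟩, h3⟩
        have hi : ∀ g x, a g⁻¹ (a g x) = x := fun g x => by rw [← h2, inv_mul_cancel, h1]
        have hi' : ∀ g x, a g (a g⁻¹ x) = x := fun g x => by rw [← h2, mul_inv_cancel, h1]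
        have hs : ∀ g, StrictMono (a g) := fun g =>
          Monotone.strictMono_of_injective (h3 g) (Function.LeftInverse.injective (hi g))
        let F : G → Homeo0 := fun g =>
          ⟨⟨⟨a g, a g⁻¹, hi g, hi' g⟩, (a g).continuous, (a g⁻¹).continuous⟩, hs g⟩
        refine ⟨MonoidHom.mk' F fun g h => homeo0_ext fun x => h2 g h x, ?_⟩
        rfl
    rw [hr]
    refine (IsClosed.inter ?_ ?_).inter ?_
    · exact isClosed_iInter fun x => isClosed_eq (by fun_prop) (by fun_prop)
    · refine isClosed_iInter fun g => isClosed_iInter fun h => isClosed_iInter fun x =>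
        isClosed_eq (by fun_prop) (by fun_prop)
    · exact isClosed_iInter fun g => isClosed_iInter fun x => isClosed_iInter fun y =>
        isClosed_iInter fun _ => isClosed_le (by fun_prop) (by fun_prop)

instance polishSpace_act [Countable G] : PolishSpace (Act G) :=
  isClosedEmbedding_actToC.polishSpace

/-! ### Minimal actions and semiconjugacies -/

theorem exists_apply_mem_Ioo {φ : Act G} (hφ : φ ∈ repMin G) (x : ℝ) {a b : ℝ} (h : a < b) :
    ∃ g, φ g x ∈ Set.Ioo a b := by
  obtain ⟨_, ⟨g, rfl⟩, hy⟩ := (hφ x).exists_between h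
  exact ⟨g, hy⟩

theorem repMin_subset_repIrr : repMin G ⊆ repIrr G := by
  rintro φ hφ ⟨x, hx⟩
  obtain ⟨g, hg⟩ := exists_apply_mem_Ioo hφ x (lt_add_one x)
  rw [hx g] at hg
  exact lt_irrefl _ hg.1

theorem conj_mem_repMin {φ : Act G} (hφ : φ ∈ repMin G) (f : Homeo0) : conj f φ ∈ repMin G := by
  intro x
  exact (f : ℝ ≃ₜ ℝ).surjective.denseRange.comp (hφ (f⁻¹ x)) (homeo0_continuous f)

theorem conj_mem_repMin_iff {φ : Act G} (f : Homeo0) : conj f φ ∈ repMin G ↔ φ ∈ repMin G := by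
  refine ⟨fun h => ?_, fun h => conj_mem_repMin h f⟩
  have := conj_mem_repMin h f⁻¹
  rwa [← conj_mul, inv_mul_cancel, conj_one] at this

theorem strictMono_of_isSemiconj {φ ψ : Act G} (hφ : φ ∈ repMin G) (hψ : ψ ∈ repIrr G)
    {h : ℝ → ℝ} (hh : IsSemiconj h φ ψ) : StrictMono h := by
  refine hh.1.strictMono_of_injective fun a b hab => ?_
  by_contra hne
  wlog hlt : a < b generalizing a b
  · exact this b a hab.symm (Ne.symm hne) (lt_of_le_of_ne (not_lt.1 hlt) (Ne.symm hne))
  refine hψ ⟨h 0, fun g => ?_⟩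
  rw [← hh.2]
  -- Minimality carries every point into the interval where `h` is constant; the global value of `h`
  -- would then be a fixed point of `ψ`.
  have hloc : IsLocallyConstant h := by
    rw [IsLocallyConstant.iff_eventually_eq]
    intro x
    obtain ⟨k, hk⟩ := exists_apply_mem_Ioo hφ x hlt
    have hc : ∀ y ∈ Set.Ioo a b, h y = h a := fun y hy =>
      le_antisymm ((hh.1 hy.2.le).trans hab.symm.le) (hh.1 hy.1.le)
    filter_upwards [(homeo0_continuous (φ k)).continuousAt.preimage_mem_nhds
      (isOpen_Ioo.mem_nhds hk)] with y hy
    apply (homeo0_strictMono (ψ k)).injective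
    rw [← hh.2, ← hh.2, hc _ hk, hc _ hy]
  exact hloc.apply_eq_of_preconnectedSpace _ _

theorem denseRange_of_isSemiconj {φ ψ : Act G} (hψ : ψ ∈ repMin G)
    {h : ℝ → ℝ} (hh : IsSemiconj h φ ψ) : DenseRange h := by
  refine (hψ (h 0)).mono ?_
  rintro _ ⟨g, rfl⟩
  exact ⟨φ g 0, hh.2 g 0⟩

/-- Minimality of `φ` excludes flat pieces of `h`, and minimality of `ψ` excludes jumps. -/
theorem exists_homeo0_of_isSemiconj {φ ψ : Act G} (hφ : φ ∈ repMin G) (hψ : ψ ∈ repMin G)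
    {h : ℝ → ℝ} (hh : IsSemiconj h φ ψ) : ∃ k : Homeo0, (∀ x, k x = h x) ∧ conj k φ = ψ := by
  have hd := denseRange_of_isSemiconj hψ hh
  have hs := strictMono_of_isSemiconj hφ (repMin_subset_repIrr hψ) hh
  have hc : Continuous h := hh.1.continuous_of_denseRange hd
  have hsurj : Function.Surjective h := fun y => by
    obtain ⟨_, ⟨a, rfl⟩, hy1⟩ := hd.exists_between (sub_one_lt y)
    obtain ⟨_, ⟨b, rfl⟩, hy2⟩ := hd.exists_between (lt_add_one y)
    exact mem_range_of_exists_le_of_exists_ge hc ⟨a, hy1.2.le⟩ ⟨b, hy2.1.le⟩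
  refine ⟨⟨(hs.orderIsoOfSurjective h hsurj).toHomeomorph, hs⟩, fun x => rfl, ?_⟩
  exact conj_eq_iff.2 hh.2

/-- A monotone map that intertwines two minimal actions up to its jumps is a conjugacy. -/
theorem exists_homeo0_of_weak_semiconj {φ ψ : Act G} (hφ : φ ∈ repMin G) (hψ : ψ ∈ repMin G)
    {h : ℝ → ℝ} (hm : Monotone h) (hle : ∀ g x y, ψ g x < y → φ g (h x) ≤ h y) :
    ∃ k : Homeo0, (∀ x, k x = h x) ∧ conj k ψ = φ := by
  -- Left limits fix the ambiguity at the jumps; applying this inequality to `g⁻¹` gives the reverse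
  -- one.
  have key : ∀ g x, φ g (Function.leftLim h x) ≤ Function.leftLim h (ψ g x) := by
    intro g x
    refine le_of_tendsto (((homeo0_continuous (φ g)).tendsto _).comp (hm.tendsto_leftLim x)) ?_
    filter_upwards [self_mem_nhdsWithin] with y hy
    obtain ⟨w, hw1, hw2⟩ := exists_between (homeo0_strictMono (ψ g) hy)
    exact (hle g y w hw1).trans (hm.le_leftLim hw2)
  have hsc : IsSemiconj (Function.leftLim h) ψ φ := by
    refine ⟨hm.leftLim, fun g x => le_antisymm ?_ (key g x)⟩
    have := (homeo0_strictMono (φ g)).monotone (key g⁻¹ (ψ g x))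
    simpa using this
  obtain ⟨k, hk, hkc⟩ := exists_homeo0_of_isSemiconj hψ hφ hsc
  refine ⟨k, fun x => le_antisymm ?_ ?_, hkc⟩
  · rw [hk]
    exact hm.leftLim_le le_rfl
  · refine ge_of_tendsto ((homeo0_continuous k).continuousWithinAt (s := Set.Ioi x)) ?_
    filter_upwards [self_mem_nhdsWithin] with y hy
    rw [hk]
    exact hm.le_leftLim hy

theorem exists_lt_apply {φ : Act G} (hφ : φ ∈ repMin G) (z x : ℝ) : ∃ g, x < φ g z := by
  obtain ⟨g, hg⟩ := exists_apply_mem_Ioo hφ z (lt_add_one x)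
  exact ⟨g, hg.1⟩

theorem exists_apply_lt {φ : Act G} (hφ : φ ∈ repMin G) (z x : ℝ) : ∃ g, φ g z < x := by
  obtain ⟨g, hg⟩ := exists_apply_mem_Ioo hφ z (sub_one_lt x)
  exact ⟨g, hg.2⟩

/-- If conjugates of a minimal action converge to a minimal action and the inverses of the
conjugating maps are bounded at one point, then these inverses converge to a conjugacy. -/
theorem exists_limit_conj {ι : Type*} (u : Ultrafilter ι) {φ ψ : Act G} (hφ : φ ∈ repMin G)
    (hψ : ψ ∈ repMin G) {f : ι → Homeo0} (hf : Tendsto (fun i => conj (f i) φ) u (𝓝 ψ))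
    {z M : ℝ} (hb : ∀ᶠ i in (u : Filter ι), |(f i)⁻¹ z| ≤ M) :
    ∃ k : Homeo0, (∀ x, Tendsto (fun i => (f i)⁻¹ x) u (𝓝 (k x))) ∧ conj k ψ = φ := by
  rw [tendsto_act_iff] at hf
  have hequiv : ∀ i g x, (f i)⁻¹ (conj (f i) φ g x) = φ g ((f i)⁻¹ x) := by
    intro i g x
    rw [conj_apply, homeo0_inv_apply_self]
  have hlim : ∀ x, ∃ y, Tendsto (fun i => (f i)⁻¹ x) u (𝓝 y) := by
    intro x
    -- Elements of `G` that move `z` past `x` on either side propagate the bound from `z` to `x`.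
    obtain ⟨g, hg⟩ := exists_lt_apply hψ z x
    obtain ⟨g', hg'⟩ := exists_apply_lt hψ z x
    have hmem : ∀ᶠ i in (u : Filter ι), (f i)⁻¹ x ∈ Set.Icc (φ g' (-M)) (φ g M) := by
      filter_upwards [hb, (hf g z).eventually_const_lt hg, (hf g' z).eventually_lt_const hg']
        with i h1 h2 h3
      constructor
      · refine le_trans ?_ ((homeo0_strictMono (f i)⁻¹).monotone h3.le)
        rw [hequiv]
        exact (homeo0_strictMono _).monotone (abs_le.1 h1).1
      · refine ((homeo0_strictMono (f i)⁻¹).monotone h2.le).trans ?_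
        rw [hequiv]
        exact (homeo0_strictMono _).monotone (abs_le.1 h1).2
    obtain ⟨y, -, hy⟩ := isCompact_Icc.ultrafilter_le_nhds (u.map fun i => (f i)⁻¹ x)
      (le_principal_iff.2 hmem)
    exact ⟨y, hy⟩
  choose h hh using hlim
  have hm : Monotone h := fun x y hxy =>
    le_of_tendsto_of_tendsto' (hh x) (hh y) fun i => (homeo0_strictMono (f i)⁻¹).monotone hxy
  obtain ⟨k, hk, hkc⟩ := exists_homeo0_of_weak_semiconj hφ hψ hm
    (fun g x y hxy => by
      refine le_of_tendsto_of_tendsto (((homeo0_continuous (φ g)).tendsto _).comp (hh x)) (hh y) ?_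
      filter_upwards [(hf g x).eventually_lt_const hxy] with i hi
      rw [Function.comp_apply, ← hequiv]
      exact (homeo0_strictMono (f i)⁻¹).monotone hi.le)
  exact ⟨k, fun x => by rw [hk]; exact hh x, hkc⟩

/-- The conjugates of a minimal action by maps whose inverses send `z` to a bounded interval form a
relatively closed set of minimal actions. -/
theorem mem_of_mem_closure_bounded_conj {φ ψ : Act G} (hφ : φ ∈ repMin G) (hψ : ψ ∈ repMin G)
    {z M : ℝ} (h : ψ ∈ closure {η | ∃ f : Homeo0, |f⁻¹ z| ≤ M ∧ conj f φ = η}) :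
    ∃ f : Homeo0, |f⁻¹ z| ≤ M ∧ conj f φ = ψ := by
  obtain ⟨u, hu, hle⟩ := mem_closure_iff_ultrafilter.1 h
  have hex : ∀ η : Act G, ∃ f : Homeo0,
      η ∈ {η | ∃ f : Homeo0, |f⁻¹ z| ≤ M ∧ conj f φ = η} → |f⁻¹ z| ≤ M ∧ conj f φ = η := by
    intro η
    by_cases hη : η ∈ {η | ∃ f : Homeo0, |f⁻¹ z| ≤ M ∧ conj f φ = η}
    · obtain ⟨f, hf⟩ := hη
      exact ⟨f, fun _ => hf⟩
    -- A harmless default: the ultrafilter `u` is concentrated on the other case.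
    · exact ⟨1, fun h => absurd h hη⟩
  choose F hF using hex
  have hb : ∀ᶠ η in (u : Filter (Act G)), |(F η)⁻¹ z| ≤ M := by
    filter_upwards [hu] with η hη using (hF η hη).1
  have ht : Tendsto (fun η => conj (F η) φ) u (𝓝 ψ) := by
    refine Tendsto.congr' ?_ (tendsto_id.mono_left hle)
    filter_upwards [hu] with η hη using (hF η hη).2.symm
  obtain ⟨k, hk, hkc⟩ := exists_limit_conj u hφ hψ ht hb
  refine ⟨k⁻¹, ?_, conj_inv_eq_iff.2 hkc.symm⟩
  rw [inv_inv]
  exact le_of_tendsto (hk z).abs hb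

/-- Once the target interval is rational and the starting point ranges over a compact interval,
reaching the target is an open condition on `φ`. -/
theorem isGδ_repMin : IsGδ (repMin G) := by
  have h : repMin G = ⋂ p : ℚ × ℚ, ⋂ _ : p.1 < p.2, ⋂ n : ℕ,
      {φ | ∀ x ∈ Set.Icc (-n : ℝ) n, ∃ g, φ g x ∈ Set.Ioo (p.1 : ℝ) p.2} := by
    ext φ
    simp only [Set.mem_iInter, Set.mem_ofPred_eq]
    constructor
    · intro hφ p hp n x _
      exact exists_apply_mem_Ioo hφ x (by exact_mod_cast hp)
    · intro hφ x
      refine dense_of_exists_between fun {a b} hab => ?_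
      obtain ⟨p, hap, hpb⟩ := exists_rat_btwn hab
      obtain ⟨q, hpq, hqb⟩ := exists_rat_btwn hpb
      obtain ⟨n, hn⟩ := exists_nat_ge |x|
      obtain ⟨g, hg⟩ := hφ (p, q) (by exact_mod_cast hpq) n x (abs_le.1 hn)
      exact ⟨_, ⟨g, rfl⟩, hap.trans hg.1, hg.2.trans hqb⟩
  rw [h]
  refine .iInter fun p => .iInter fun _ => .iInter fun n => IsOpen.isGδ ?_
  rw [isOpen_iff_mem_nhds]
  intro φ hφ
  refine isCompact_Icc.eventually_forall_of_forall_eventually fun x hx => ?_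
  obtain ⟨g, hg⟩ := hφ x hx
  have hc : Continuous fun p : Act G × ℝ => p.1 g p.2 := by
    have h1 : Continuous fun p : Act G × ℝ => actToC p.1 g :=
      (continuous_apply g).comp (isInducing_actToC.continuous.comp continuous_fst)
    exact h1.eval continuous_snd
  filter_upwards [hc.continuousAt.preimage_mem_nhds (isOpen_Ioo.mem_nhds hg)] with p hp
  exact ⟨g, hp⟩

/-! ### Centralizers of minimal actions -/

/-- The fixed set of `c` is closed and invariant, so it contains a dense orbit. -/
theorem eq_one_of_centralizes {φ : Act G} (hφ : φ ∈ repMin G) {c : Homeo0} (hc : conj c φ = φ)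
    {x : ℝ} (hx : c x = x) : c = 1 := by
  rw [conj_eq_iff] at hc
  refine homeo0_ext fun y => congr_fun ((homeo0_continuous c).ext_on (hφ x) continuous_id ?_) y
  rintro _ ⟨g, rfl⟩
  change c (φ g x) = φ g x
  rw [hc, hx]

/-- Contracting the pair `0`, `c 0` to a common point `z` makes `z` a fixed point of `c`. -/
theorem eq_one_of_centralizes_repIII {φ : Act G} (hφ : φ ∈ repIII G) {c : Homeo0}
    (hc : conj c φ = φ) : c = 1 := by
  obtain ⟨z, g, h0, h1⟩ := hφ.2 0 (c 0)
  refine eq_one_of_centralizes hφ.1 hc (x := z) ?_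
  refine tendsto_nhds_unique (((homeo0_continuous c).tendsto z).comp h0) (h1.congr fun n => ?_)
  rw [Function.comp_apply, conj_eq_iff.1 hc]

theorem conj_mem_repIII {φ : Act G} (hφ : φ ∈ repIII G) (f : Homeo0) : conj f φ ∈ repIII G := by
  refine ⟨conj_mem_repMin hφ.1 f, fun x y => ?_⟩
  obtain ⟨z, g, h0, h1⟩ := hφ.2 (f⁻¹ x) (f⁻¹ y)
  exact ⟨f z, g, ((homeo0_continuous f).tendsto z).comp h0,
    ((homeo0_continuous f).tendsto z).comp h1⟩

theorem exists_not_contractible {φ : Act G} (h : ¬ IsProximal φ) :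
    ∃ a b x y : ℝ, a < b ∧ x ≤ y ∧ ∀ g, φ g x ∈ Set.Ioo a b → φ g y ∉ Set.Ioo a b := by
  by_contra! hcon
  refine h fun x y => ?_
  wlog hxy : x ≤ y generalizing x y
  · obtain ⟨z, g, h1, h2⟩ := this y x (le_of_not_ge hxy)
    exact ⟨z, g, h2, h1⟩
  have hpos : ∀ n : ℕ, (-(1 / ((n : ℝ) + 1))) < 1 / ((n : ℝ) + 1) := fun n => by
    have : (0 : ℝ) < 1 / ((n : ℝ) + 1) := by positivity
    linarith
  choose g hg1 hg2 using fun n : ℕ => hcon _ _ x y (hpos n) hxy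
  have hlim := tendsto_one_div_add_atTop_nhds_zero_nat (𝕜 := ℝ)
  have hlim' : Tendsto (fun n : ℕ => -(1 / ((n : ℝ) + 1))) atTop (𝓝 0) := by simpa using hlim.neg
  exact ⟨0, g, tendsto_of_tendsto_of_tendsto_of_le_of_le hlim' hlim (fun n => (hg1 n).1.le)
    fun n => (hg1 n).2.le, tendsto_of_tendsto_of_tendsto_of_le_of_le hlim' hlim
    (fun n => (hg2 n).1.le) fun n => (hg2 n).2.le⟩

/-- A minimal action that is not proximal commutes with a homeomorphism without fixed points. -/
theorem exists_centralizing_of_not_isProximal {φ : Act G} (hφ : φ ∈ repMin G)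
    (h : ¬ IsProximal φ) : ∃ c : Homeo0, conj c φ = φ ∧ ∀ x, x < c x := by
  obtain ⟨a, b, x, y, hab, hxy, hnc⟩ := exists_not_contractible h
  -- `S w` collects the points that can enter `(a, b)` together with `w`. Its supremum depends
  -- equivariantly and monotonically on `w`, and is the required `c w`.
  let S : ℝ → Set ℝ := fun w => {v | ∃ g, φ g w ∈ Set.Ioo a b ∧ φ g v ∈ Set.Ioo a b}
  have hS : ∀ w k v, v ∈ S w → φ k v ∈ S (φ k w) := by
    rintro w k v ⟨g, h1, h2⟩
    refine ⟨g * k⁻¹, ?_, ?_⟩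
    · rwa [act_mul_apply, act_inv_apply_self]
    · rwa [act_mul_apply, act_inv_apply_self]
  -- Otherwise `x` and `y` lie between `w` and `v` and enter `(a, b)` together.
  have hbx : ∀ w ≤ x, ∀ v ∈ S w, v ≤ y := by
    rintro w hw v ⟨g, h1, h2⟩
    by_contra! hv
    have hmono := (homeo0_strictMono (φ g)).monotone
    exact hnc g ⟨h1.1.trans_le (hmono hw), (hmono (hxy.trans hv.le)).trans_lt h2.2⟩
      ⟨h1.1.trans_le (hmono (hw.trans hxy)), (hmono hv.le).trans_lt h2.2⟩
  have hbdd : ∀ w, BddAbove (S w) := by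
    intro w
    obtain ⟨k, hk⟩ := exists_apply_lt hφ w x
    refine ⟨φ k⁻¹ y, fun v hv => ?_⟩
    have := (homeo0_strictMono (φ k⁻¹)).monotone (hbx _ hk.le _ (hS w k v hv))
    rwa [act_inv_apply_self] at this
  have hself : ∀ w, w ∈ S w := by
    intro w
    obtain ⟨g, hg⟩ := exists_apply_mem_Ioo hφ w hab
    exact ⟨g, hg, hg⟩
  have hlt : ∀ w, w < sSup (S w) := by
    intro w
    obtain ⟨g, hg⟩ := exists_apply_mem_Ioo hφ w hab
    obtain ⟨v, hv1, hv2⟩ := exists_between hg.2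
    have hv : φ g⁻¹ v ∈ S w := ⟨g, hg, by
      rw [act_apply_inv_self]
      exact ⟨hg.1.trans hv1, hv2⟩⟩
    refine lt_of_lt_of_le ?_ (le_csSup (hbdd w) hv)
    rw [← (homeo0_strictMono (φ g)).lt_iff_lt, act_apply_inv_self]
    exact hv1
  have hmono : Monotone fun w => sSup (S w) := by
    intro w w' hw
    refine csSup_le ⟨w, hself w⟩ ?_
    rintro v ⟨g, h1, h2⟩
    rcases le_total v w' with hv | hv
    · exact hv.trans (hlt w').le
    · refine le_csSup (hbdd w') ⟨g, ?_, h2⟩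
      exact ⟨h1.1.trans_le ((homeo0_strictMono _).monotone hw),
        ((homeo0_strictMono _).monotone hv).trans_lt h2.2⟩
  have hle : ∀ g w, sSup (S w) ≤ φ g⁻¹ (sSup (S (φ g w))) := by
    intro g w
    refine csSup_le ⟨w, hself w⟩ fun v hv => ?_
    have := (homeo0_strictMono (φ g⁻¹)).monotone (le_csSup (hbdd _) (hS w g v hv))
    rwa [act_inv_apply_self] at this
  have hsc : IsSemiconj (fun w => sSup (S w)) φ φ := by
    refine ⟨hmono, fun g w => le_antisymm ?_ ?_⟩
    · simpa using hle g⁻¹ (φ g w)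
    · simpa using (homeo0_strictMono (φ g)).monotone (hle g w)
  obtain ⟨c, hc, hcc⟩ := exists_homeo0_of_isSemiconj hφ hφ hsc
  exact ⟨c, hcc, fun w => by rw [hc]; exact hlt w⟩

theorem exists_lt_pow_apply {c : Homeo0} (hc : ∀ x, x < c x) (x y : ℝ) :
    ∃ n : ℕ, y < (c ^ n) x := by
  by_contra! hle
  have hsucc : ∀ n : ℕ, (c ^ (n + 1)) x = c ((c ^ n) x) := fun n => by rw [pow_succ']; rfl
  have hm : Monotone fun n : ℕ => (c ^ n) x := monotone_nat_of_le_succ fun n => by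
    rw [hsucc]
    exact (hc _).le
  have ht := tendsto_atTop_ciSup hm ⟨y, by rintro _ ⟨n, rfl⟩; exact hle n⟩
  have ht' := (tendsto_add_atTop_iff_nat 1).2 ht
  simp only [hsucc] at ht'
  exact (hc _).ne (tendsto_nhds_unique ht' (((homeo0_continuous c).tendsto _).comp ht))

/-- Push `y` below `0` by a power of `c⁻¹`; the first return above `0` lies in `(0, c 0]`. -/
theorem exists_centralizing_apply_le {φ : Act G} {c : Homeo0} (hcφ : conj c φ = φ)
    (hc : ∀ x, x < c x) (y : ℝ) : ∃ d : Homeo0, conj d φ = φ ∧ |d y| ≤ c 0 := by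
  have hpow : ∀ n : ℕ, conj (c ^ n) φ = φ := by
    intro n
    induction n with
    | zero => rw [pow_zero, conj_one]
    | succ n ih => rw [pow_succ, conj_mul, hcφ, ih]
  obtain ⟨m, hm⟩ := exists_lt_pow_apply hc 0 y
  have hneg : (c ^ m)⁻¹ y < 0 := by rwa [homeo0_inv_lt_iff]
  classical
  have hex : ∃ n : ℕ, 0 < (c ^ n) ((c ^ m)⁻¹ y) := exists_lt_pow_apply hc _ _
  refine ⟨c ^ Nat.find hex * (c ^ m)⁻¹, ?_, ?_⟩
  · rw [conj_mul, conj_inv_eq_iff.2 (hpow m).symm, hpow]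
  · have hpos := Nat.find_spec hex
    obtain ⟨k, hk⟩ : ∃ k, Nat.find hex = k + 1 := by
      refine Nat.exists_eq_succ_of_ne_zero fun h0 => ?_
      rw [h0, pow_zero] at hpos
      exact lt_asymm hneg hpos
    have hmin := Nat.find_min hex (m := k) (by omega)
    rw [homeo0_mul_apply, abs_of_pos hpos, hk, pow_succ']
    exact (homeo0_strictMono c).monotone (not_lt.1 hmin)

/-! ### Orbits of conjugacy and their closures -/

/-- The set of actions conjugate to `φ`. -/
def conjOrbit (φ : Act G) : Set (Act G) := Set.range fun f : Homeo0 => conj f φ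

theorem mem_conjOrbit_of_not_isProximal {φ ψ : Act G} (hφ : φ ∈ repMin G) (hψ : ψ ∈ repMin G)
    (hp : ¬ IsProximal φ) (h : ψ ∈ closure (conjOrbit φ)) : ψ ∈ conjOrbit φ := by
  obtain ⟨c, hcφ, hc⟩ := exists_centralizing_of_not_isProximal hφ hp
  obtain ⟨f, -, hf⟩ := mem_of_mem_closure_bounded_conj hφ hψ (z := 0) (M := c 0)
    (closure_mono (by
      rintro _ ⟨f, rfl⟩
      obtain ⟨d, hd, hdl⟩ := exists_centralizing_apply_le hcφ hc (f⁻¹ 0)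
      refine ⟨f * d⁻¹, ?_, ?_⟩
      · rwa [mul_inv_rev, inv_inv]
      · rw [conj_mul, conj_inv_eq_iff.2 hd.symm]) h)
  exact ⟨f, hf⟩

theorem conj_mem_conjOrbit {φ ψ : Act G} (h : ψ ∈ conjOrbit φ) (f : Homeo0) :
    conj f ψ ∈ conjOrbit φ := by
  obtain ⟨k, rfl⟩ := h
  exact ⟨f * k, conj_mul f k φ⟩

/-- Otherwise conjugates converging to `φ` would give an almost centralizing sequence with
`|f_n⁻¹(0)| > 1`, hence not tending to the identity. -/
theorem eventually_bounded_of_almostCentralizes [Countable G] {φ : Act G}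
    (h : ∀ f : ℕ → Homeo0, AlmostCentralizes f φ → Tendsto f atTop (𝓝 1)) :
    ∀ᶠ η in 𝓝 φ, ∀ f : Homeo0, conj f φ = η → |f⁻¹ 0| ≤ 1 := by
  by_contra hcon
  obtain ⟨η, hη, hf⟩ := exists_seq_forall_of_frequently (not_eventually.1 hcon)
  push Not at hf
  choose f hfη hlt using hf
  have hlim := h f (by simpa only [AlmostCentralizes, hfη] using hη)
  have h0 := tendsto_inv_apply (tendsto_homeo0_iff.1 hlim) 0
  rw [inv_one, homeo0_one_apply] at h0
  obtain ⟨n, hn⟩ := ((h0.abs).eventually_lt_const (u := 1) (by simp)).exists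
  exact lt_asymm hn (hlt n)

/-- Some `k.ψ` lies where conjugators from `φ` are bounded; pulling back by `k` bounds those near
`ψ` at the point `k⁻¹ 0`. -/
theorem mem_conjOrbit_of_eventually_bounded {φ ψ : Act G} (hφ : φ ∈ repMin G) (hψ : ψ ∈ repMin G)
    (hb : ∀ᶠ η in 𝓝 φ, ∀ f : Homeo0, conj f φ = η → |f⁻¹ 0| ≤ 1)
    (h1 : ψ ∈ closure (conjOrbit φ)) (h2 : φ ∈ closure (conjOrbit ψ)) : ψ ∈ conjOrbit φ := by
  obtain ⟨_, hk, k, rfl⟩ := mem_closure_iff_nhds.1 h2 _ (eventually_eventually_nhds.2 hb)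
  have hev : ∀ᶠ η in 𝓝 ψ, ∀ f : Homeo0, conj f φ = conj k η → |f⁻¹ 0| ≤ 1 :=
    ((continuous_conj k).tendsto ψ).eventually hk
  obtain ⟨f, -, hf⟩ := mem_of_mem_closure_bounded_conj hφ hψ (z := k⁻¹ 0) (M := 1)
    (mem_closure_iff_frequently.2 (((mem_closure_iff_frequently.1 h1).and_eventually hev).mono (by
      rintro _ ⟨⟨f, rfl⟩, hf⟩
      refine ⟨f, ?_, rfl⟩
      have := hf (k * f) (conj_mul k f φ)
      rwa [mul_inv_rev] at this)))
  exact ⟨f, hf⟩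

theorem tendsto_one_of_bounded {φ : Act G} (hφ : φ ∈ repIII G)
    (h : ∀ f : ℕ → Homeo0, AlmostCentralizes f φ →
      ∃ z : ℝ, Bornology.IsBounded (Set.range fun n : ℕ => (f n)⁻¹ z))
    (f : ℕ → Homeo0) (hf : AlmostCentralizes f φ) : Tendsto f atTop (𝓝 1) := by
  obtain ⟨z, hz⟩ := h f hf
  obtain ⟨M, hM⟩ := hz.exists_norm_le
  rw [tendsto_iff_ultrafilter]
  intro u hu
  obtain ⟨k, hk, hkc⟩ := exists_limit_conj u hφ.1 hφ.1 (hf.mono_left hu) (z := z) (M := M)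
    (Eventually.of_forall fun n => hM _ ⟨n, rfl⟩)
  obtain rfl := eq_one_of_centralizes_repIII hφ hkc
  have := tendsto_inv_apply (F := fun n => (f n)⁻¹) hk
  rw [tendsto_homeo0_iff]
  simpa using this

/-- The family of the basic open sets that are visited by the conjugates of an action. -/
def visited [Countable G] (φ : repMin G) (U : TopologicalSpace.countableBasis (Act G)) : Prop :=
  ∃ f : Homeo0, conj f (φ : Act G) ∈ U.1

theorem visited_conj [Countable G] {φ ψ : repMin G} {f : Homeo0}
    (h : conj f (φ : Act G) = ψ) (U : TopologicalSpace.countableBasis (Act G)) :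
    visited ψ U → visited φ U := by
  rintro ⟨k, hk⟩
  refine ⟨k * f, ?_⟩
  rwa [conj_mul, h]

theorem mem_closure_of_visited_eq [Countable G] {φ ψ : repMin G} (h : visited φ = visited ψ) :
    (ψ : Act G) ∈ closure (conjOrbit (φ : Act G)) := by
  rw [(TopologicalSpace.isBasis_countableBasis (Act G)).mem_closure_iff]
  intro U hU hψ
  have hv : visited ψ ⟨U, hU⟩ := ⟨1, by rwa [conj_one]⟩
  rw [← h] at hv
  obtain ⟨f, hf⟩ := hv
  exact ⟨_, hf, f, rfl⟩

/-- `visited` takes equal values exactly when each class lies in the closure of the other. Its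
coordinates are open conditions, and its countable product of truth values embeds measurably in `ℝ`.
-/
theorem inClassC_of_separated [Countable G]
    (h : ∀ φ ∈ repMin G, ∀ ψ ∈ repMin G, ψ ∈ closure (conjOrbit φ) → φ ∈ closure (conjOrbit ψ) →
      ψ ∈ conjOrbit φ) : InClassC G := by
  refine ⟨inferInstance, ?_⟩
  let : MeasurableSpace (repMin G) := borel _
  have : BorelSpace (repMin G) := ⟨rfl⟩
  have : Countable (TopologicalSpace.countableBasis (Act G)) :=
    (TopologicalSpace.countable_countableBasis _).to_subtype
  obtain ⟨j, hj⟩ :=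
    MeasureTheory.exists_measurableEmbedding_real (TopologicalSpace.countableBasis (Act G) → Prop)
  refine ⟨fun φ => j (visited φ), hj.measurable.comp (measurable_pi_lambda _ fun U => ?_), ?_⟩
  · refine measurableSet_setOfPred.1 (IsOpen.measurableSet ?_)
    simp only [visited, Set.ofPred_exists]
    refine isOpen_iUnion fun f => ?_
    exact (TopologicalSpace.isOpen_of_mem_countableBasis U.2).preimage
      ((continuous_conj f).comp continuous_subtype_val)
  · intro φ ψ
    rw [hj.injective.eq_iff]
    constructor
    · rintro ⟨f, hf⟩
      funext U
      exact propext ⟨visited_conj (conj_inv_eq_iff.2 hf.symm) U, visited_conj hf U⟩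
    · intro hv
      exact h φ φ.2 ψ ψ.2 (mem_closure_of_visited_eq hv) (mem_closure_of_visited_eq hv.symm)

/-! ### Generic ergodicity and recurrence -/

/-- Topological zero-one law: if `A` and its complement both agreed with nonempty open sets modulo
meagre sets, an `F` preserving `A` would make these overlap. -/
theorem mem_residual_or_compl_mem_residual {Y : Type*} [TopologicalSpace Y] [BaireSpace Y]
    {A : Set Y} (hA : BaireMeasurableSet A)
    (ht : ∀ U V : Set Y, IsOpen U → IsOpen V → U.Nonempty → V.Nonempty →
      ∃ F : Y ≃ₜ Y, F ⁻¹' A = A ∧ (U ∩ F ⁻¹' V).Nonempty) :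
    A ∈ residual Y ∨ Aᶜ ∈ residual Y := by
  obtain ⟨U, hU, hAU⟩ := hA.residualEq_isOpen
  obtain ⟨V, hV, hAV⟩ := hA.compl.residualEq_isOpen
  rcases U.eq_empty_or_nonempty with rfl | hUne
  · right
    filter_upwards [hAU.mem_iff] with y hy using fun h => hy.1 h
  rcases V.eq_empty_or_nonempty with rfl | hVne
  · left
    filter_upwards [hAV.mem_iff] with y hy
    by_contra h
    exact hy.1 h
  exfalso
  obtain ⟨F, hF, hne⟩ := ht U V hU hV hUne hVne
  have hFV : ∀ᶠ y in residual Y, F y ∈ Aᶜ ↔ F y ∈ V :=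
    (tendsto_residual_of_isOpenMap F.continuous F.isOpenMap).eventually hAV.mem_iff
  obtain ⟨y, ⟨hyU, hyV⟩, h1, h2⟩ := (dense_of_mem_residual (hAU.mem_iff.and hFV)).inter_open_nonempty
    _ (hU.inter (hV.preimage F.continuous)) hne
  have hyA : y ∈ F ⁻¹' A := by
    rw [hF]
    exact h1.2 hyU
  exact h2.2 hyV hyA

theorem conj_mem_closure_conjOrbit_iff {φ ψ : Act G} (f : Homeo0) :
    ψ ∈ closure (conjOrbit φ) ↔ conj f ψ ∈ closure (conjOrbit φ) := by
  have h : ∀ (f : Homeo0) {ψ : Act G}, ψ ∈ closure (conjOrbit φ) →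
      conj f ψ ∈ closure (conjOrbit φ) := fun f ψ hψ =>
    map_mem_closure (continuous_conj f) hψ fun _ hη => conj_mem_conjOrbit hη f
  refine ⟨h f, fun hψ => ?_⟩
  have := h f⁻¹ hψ
  rwa [conj_inv_eq_iff.2 rfl] at this

/-- The minimal actions in the closure of the conjugacy class of `φ`. -/
def minClosure (φ : Act G) : Set (closure (conjOrbit φ)) := {ψ | (ψ : Act G) ∈ repMin G}

theorem isInducing_minClosure (φ : Act G) : IsInducing fun y : minClosure φ => (y.1.1 : Act G) :=
  IsInducing.subtypeVal.comp IsInducing.subtypeVal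

theorem dense_conjOrbit_minClosure {φ : Act G} (hφ : φ ∈ repMin G) :
    Dense {y : minClosure φ | (y.1.1 : Act G) ∈ conjOrbit φ} := by
  intro y
  rw [(isInducing_minClosure φ).closure_eq_preimage_closure_image]
  refine closure_mono ?_ y.1.2
  rintro _ ⟨f, rfl⟩
  exact ⟨⟨⟨conj f φ, subset_closure ⟨f, rfl⟩⟩, conj_mem_repMin hφ f⟩, ⟨f, rfl⟩, rfl⟩

theorem baireSpace_minClosure [Countable G] {φ : Act G} (hφ : φ ∈ repMin G) :
    BaireSpace (minClosure φ) := by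
  have : PolishSpace (closure (conjOrbit φ)) := isClosed_closure.polishSpace
  refine IsGδ.baireSpace_of_dense ?_ ?_
  · exact isGδ_repMin.preimage continuous_subtype_val
  · rw [Subtype.dense_iff]
    refine closure_mono ?_
    rintro _ ⟨f, rfl⟩
    exact ⟨⟨conj f φ, subset_closure ⟨f, rfl⟩⟩, conj_mem_repMin hφ f, rfl⟩

/-- Conjugation by `f` on the minimal actions in the closure of a conjugacy class. -/
def conjMinClosure (φ : Act G) (f : Homeo0) : minClosure φ ≃ₜ minClosure φ :=
  ((conjHomeomorph f).subtype (fun _ => conj_mem_closure_conjOrbit_iff f) :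
    closure (conjOrbit φ) ≃ₜ closure (conjOrbit φ)).subtype
    fun _ => (conj_mem_repMin_iff f).symm

theorem conjMinClosure_val (φ : Act G) (f : Homeo0) (y : minClosure φ) :
    (conjMinClosure φ f y).1.1 = conj f y.1.1 := rfl

theorem eventuallyEq_const_of_invariant [Countable G] {φ : Act G} (hφ : φ ∈ repMin G)
    {e : repMin G → ℝ} (hm : @Measurable _ _ (borel (repMin G)) _ e)
    (he : ∀ (ψ η : repMin G) (f : Homeo0), conj f (ψ : Act G) = η → e ψ = e η) :
    ∃ a, ∀ᶠ y : minClosure φ in residual _, e ⟨y.1.1, y.2⟩ = a := by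
  have := baireSpace_minClosure hφ
  let : MeasurableSpace (repMin G) := borel _
  have : BorelSpace (repMin G) := ⟨rfl⟩
  let : MeasurableSpace (minClosure φ) := borel _
  have : BorelSpace (minClosure φ) := ⟨rfl⟩
  have hc : Continuous fun y : minClosure φ => (⟨y.1.1, y.2⟩ : repMin G) :=
    Continuous.subtype_mk (isInducing_minClosure φ).continuous _
  refine exists_eventuallyEq_const_of_forall_separating MeasurableSet fun B hB => ?_
  refine mem_residual_or_compl_mem_residual
    (A := (fun y : minClosure φ => e ⟨y.1.1, y.2⟩) ⁻¹' B)
    ((hm.comp hc.measurable) hB).baireMeasurableSet fun U V hU hV hUne hVne => ?_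
  have hd := dense_conjOrbit_minClosure hφ
  obtain ⟨y, hyU, k, hk⟩ := hd.inter_open_nonempty U hU hUne
  obtain ⟨w, hwV, l, hl⟩ := hd.inter_open_nonempty V hV hVne
  -- This conjugation takes `k.φ` in `U` to `l.φ` in `V`.
  refine ⟨conjMinClosure φ (l * k⁻¹), ?_, y, hyU, ?_⟩
  · ext v
    have := he ⟨v.1.1, v.2⟩ ⟨_, (conjMinClosure φ (l * k⁻¹) v).2⟩ (l * k⁻¹) rfl
    simp only [Set.mem_preimage]
    rw [this]
  · have hw : conjMinClosure φ (l * k⁻¹) y = w := by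
      refine Subtype.ext (Subtype.ext ?_)
      rw [conjMinClosure_val, conj_mul, conj_inv_eq_iff.2 hk.symm]
      exact hl
    rw [Set.mem_preimage, hw]
    exact hwV

theorem isBounded_of_inClassC {φ : Act G} (hC : InClassC G) (hφ : φ ∈ repIII G)
    {f : ℕ → Homeo0} (hf : AlmostCentralizes f φ) :
    ∃ z : ℝ, Bornology.IsBounded (Set.range fun n : ℕ => (f n)⁻¹ z) := by
  obtain ⟨hG, e, hm, he⟩ := hC
  have := baireSpace_minClosure hφ.1
  obtain ⟨a, ha⟩ := eventuallyEq_const_of_invariant hφ.1 hm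
    fun ψ η k hk => (he ψ η).1 ⟨k, hk⟩
  have : Nonempty (minClosure φ) :=
    ⟨⟨⟨φ, subset_closure ⟨1, conj_one φ⟩⟩, hφ.1⟩⟩
  obtain ⟨ψ, hψ⟩ := (dense_of_mem_residual ha).nonempty
  let A : ℕ → Set (minClosure φ) := fun n => {y | ∃ k : Homeo0, |k⁻¹ 0| ≤ n ∧ conj k ψ.1.1 = y.1.1}
  have hAc : ∀ n, IsClosed (A n) := by
    intro n
    refine isClosed_of_closure_subset fun y hy => ?_
    rw [(isInducing_minClosure φ).closure_eq_preimage_closure_image] at hy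
    refine mem_of_mem_closure_bounded_conj ψ.2 y.2 (closure_mono ?_ hy)
    rintro _ ⟨w, hw, rfl⟩
    exact hw
  -- The comeagre level set of `e` is one conjugacy class, covered by the closed sets `A n`.
  have hint : ∃ n, (interior (A n)).Nonempty := by
    by_contra! hem
    have hres : ∀ᶠ y in residual _, ∀ n, y ∉ A n := by
      rw [eventually_countable_forall]
      exact fun n => residual_of_dense_open (hAc n).isOpen_compl
        (interior_eq_empty_iff_dense_compl.1 (hem n))
    obtain ⟨y, hy, hyA⟩ := (dense_of_mem_residual (ha.and hres)).nonempty
    obtain ⟨k, hk⟩ := (he ⟨_, ψ.2⟩ ⟨_, y.2⟩).2 (hψ.trans hy.symm)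
    obtain ⟨n, hn⟩ := exists_nat_ge |k⁻¹ 0|
    exact hyA n ⟨k, hn, hk⟩
  obtain ⟨n, hn⟩ := hint
  obtain ⟨y, hy, f₀, hf₀⟩ :=
    (dense_conjOrbit_minClosure hφ.1).inter_open_nonempty _ isOpen_interior hn
  obtain ⟨p, hp⟩ : ∃ p, conj p φ = ψ.1.1 := by
    obtain ⟨k, -, hk⟩ := interior_subset hy
    refine ⟨k⁻¹ * f₀, ?_⟩
    rw [conj_mul, conj_inv_eq_iff, hk]
    exact hf₀
  -- Eventually `f₀ * f m` moves `φ` into `A n`, so it conjugates `φ` as some `k * p` does; the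
  -- trivial centralizer makes the two equal.
  have hev : ∀ᶠ m in atTop, ∃ k : Homeo0, |k⁻¹ 0| ≤ n ∧ k * p = f₀ * f m := by
    let w : ℕ → minClosure φ := fun m =>
      ⟨⟨conj f₀ (conj (f m) φ), subset_closure ⟨f₀ * f m, conj_mul _ _ _⟩⟩,
        conj_mem_repMin (conj_mem_repMin hφ.1 _) _⟩
    have hw : Tendsto w atTop (𝓝 y) := by
      rw [(isInducing_minClosure φ).tendsto_nhds_iff, ← hf₀]
      exact ((continuous_conj f₀).tendsto φ).comp hf
    filter_upwards [hw (mem_interior_iff_mem_nhds.1 hy)] with m hm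
    obtain ⟨k, hk, hkc⟩ := hm
    refine ⟨k, hk, ?_⟩
    rw [← hp, ← conj_mul] at hkc
    rw [← inv_mul_eq_one]
    refine eq_one_of_centralizes_repIII hφ ?_
    rw [conj_mul, conj_inv_eq_iff, hkc, conj_mul]
  have hIcc : ∀ᶠ m in atTop, (f m)⁻¹ (f₀⁻¹ 0) ∈ Set.Icc (p⁻¹ (-n)) (p⁻¹ n) := by
    filter_upwards [hev] with m hm
    obtain ⟨k, hk, hkm⟩ := hm
    have : (f m)⁻¹ (f₀⁻¹ 0) = p⁻¹ (k⁻¹ 0) := by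
      change ((f m)⁻¹ * f₀⁻¹) 0 = (p⁻¹ * k⁻¹) 0
      rw [← mul_inv_rev, ← mul_inv_rev, hkm]
    rw [this]
    exact ⟨(homeo0_strictMono _).monotone (abs_le.1 hk).1,
      (homeo0_strictMono _).monotone (abs_le.1 hk).2⟩
  refine ⟨f₀⁻¹ 0, isBounded_iff_bddBelow_bddAbove.2 ⟨?_, ?_⟩⟩
  · exact IsBoundedUnder.bddBelow_range ⟨_, eventually_map.2 (hIcc.mono fun m hm => hm.1)⟩
  · exact IsBoundedUnder.bddAbove_range ⟨_, eventually_map.2 (hIcc.mono fun m hm => hm.2)⟩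

/-! ### Spaces of harmonic actions -/

theorem repCyc_map_mul_comm {φ : Act G} (hφ : φ ∈ repCyc G) (g k : G) :
    φ (g * k) = φ (k * g) := by
  obtain ⟨-, p, ψ, rfl⟩ := hφ
  simp only [MonoidHom.comp_apply, map_mul p, mul_comm]

/-- If the image were abelian, each `φ g` would centralize `φ` and so be trivial. Noncommutativity
is what rules out cyclic actions below. -/
theorem exists_map_mul_ne_of_repIII {φ : Act G} (hφ : φ ∈ repIII G) :
    ∃ g k, φ (g * k) ≠ φ (k * g) := by
  by_contra! hcomm
  refine repMin_subset_repIrr hφ.1 ⟨0, fun g => ?_⟩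
  have : φ g = 1 := eq_one_of_centralizes_repIII hφ (conj_eq_iff.2 fun k x => by
    rw [← act_mul_apply, hcomm, act_mul_apply])
  rw [this, homeo0_one_apply]

theorem repMin_of_isSemiconj_from_repIII {φ η : Act G} (hφ : φ ∈ repIII G)
    (hη : η ∈ repMin G ∪ repCyc G) {h : ℝ → ℝ} (hh : IsSemiconj h φ η) : η ∈ repMin G := by
  refine hη.resolve_right fun hcyc => ?_
  have hs := strictMono_of_isSemiconj hφ.1 hcyc.1 hh
  obtain ⟨g, k, hgk⟩ := exists_map_mul_ne_of_repIII hφ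
  refine hgk (homeo0_ext fun x => hs.injective ?_)
  rw [hh.2, hh.2, repCyc_map_mul_comm hcyc]

theorem repMin_of_isSemiconj_to_repIII {ρ η : Act G} (hη : η ∈ repIII G)
    (hρ : ρ ∈ repMin G ∪ repCyc G) {h : ℝ → ℝ} (hh : IsSemiconj h ρ η) : ρ ∈ repMin G := by
  refine hρ.resolve_right fun hcyc => ?_
  obtain ⟨g, k, hgk⟩ := exists_map_mul_ne_of_repIII hη
  refine hgk (homeo0_ext fun x => congr_fun ?_ x)
  refine (denseRange_of_isSemiconj hη.1 hh).equalizer (homeo0_continuous _) (homeo0_continuous _) ?_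
  funext y
  change η (g * k) (h y) = η (k * g) (h y)
  rw [← hh.2, ← hh.2, repCyc_map_mul_comm hcyc]

/-- A minimal or cyclic action that is pointed semiconjugate to an action of type III is conjugate
to it. -/
theorem PointedSemiconj.exists_homeo0 {φ ρ : Act G} (h : PointedSemiconj φ ρ) (hφ : φ ∈ repIII G)
    (hρ : ρ ∈ repMin G ∪ repCyc G) : ∃ F : Homeo0, conj F φ = ρ := by
  obtain ⟨η, hη, h₁, h₂, hs₁, hs₂, -⟩ := h
  have hηmin := repMin_of_isSemiconj_from_repIII hφ hη hs₁
  obtain ⟨k₁, -, rfl⟩ := exists_homeo0_of_isSemiconj hφ.1 hηmin hs₁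
  have hρmin := repMin_of_isSemiconj_to_repIII (conj_mem_repIII hφ k₁) hρ hs₂
  obtain ⟨k₂, -, hc⟩ := exists_homeo0_of_isSemiconj hρmin hηmin hs₂
  refine ⟨k₂⁻¹ * k₁, ?_⟩
  rw [conj_mul, conj_inv_eq_iff, hc]

theorem pointedSemiconj_of_conj {φ ρ : Act G} (hρ : ρ ∈ repMin G) {F : Homeo0} (h0 : F 0 = 0)
    (h : conj F φ = ρ) : PointedSemiconj φ ρ :=
  ⟨ρ, Or.inl hρ, F, id, ⟨(homeo0_strictMono F).monotone, conj_eq_iff.1 h⟩,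
    ⟨monotone_id, fun _ _ => rfl⟩, h0⟩

theorem isBounded_of_flow {H : Set (Act G)} (hH : IsHarmonicSpace G H)
    (h4 : ∀ φ ∈ repIII G ∩ H, ∀ t : ℕ → ℝ,
      Tendsto (fun n : ℕ => flow (t n) φ) atTop (𝓝 φ) → Tendsto t atTop (𝓝 0))
    {φ : Act G} (hφ : φ ∈ repIII G) {f : ℕ → Homeo0} (hf : AlmostCentralizes f φ) :
    ∃ z : ℝ, Bornology.IsBounded (Set.range fun n : ℕ => (f n)⁻¹ z) := by
  obtain ⟨r, hrc, hretr, hfib⟩ := hH.exists_retraction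
  have hirr : ∀ ψ : Act G, ψ ∈ repMin G → ψ ∈ repIrr G := fun ψ h => repMin_subset_repIrr h
  let φ' : repIrr G := ⟨φ, hirr _ hφ.1⟩
  have hρ : (r φ').1 ∈ repMin G ∪ repCyc G := hH.min_or_cyc (r φ').2
  have hps : PointedSemiconj φ (r φ').1 :=
    (hfib φ' ⟨_, hH.subset_irr (r φ').2⟩).1
      (Subtype.ext (hretr ⟨_, hH.subset_irr (r φ').2⟩ (r φ').2).symm)
  obtain ⟨F, hF⟩ := hps.exists_homeo0 hφ hρ
  have hρIII : (r φ').1 ∈ repIII G := hF ▸ conj_mem_repIII hφ F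
  -- The map `F * (f n)⁻¹` conjugates `f_n.φ` to `r φ'` and sends `0` to `F ((f n)⁻¹ 0)`; the
  -- translation restores the base point.
  have hval : ∀ n, ((r ⟨conj (f n) φ, hirr _ (conj_mem_repMin hφ.1 _)⟩ : H) : Act G) =
      flow (-(F ((f n)⁻¹ 0))) (r φ').1 := by
    intro n
    have hmin : flow (-(F ((f n)⁻¹ 0))) (r φ').1 ∈ repMin G := conj_mem_repMin hρIII.1 _
    refine Eq.trans ?_ (hretr ⟨_, hirr _ hmin⟩ (hH.flow_mem _ _ (r φ').2))
    refine congrArg Subtype.val ((hfib _ _).2 ?_)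
    refine pointedSemiconj_of_conj (F := translation (-(F ((f n)⁻¹ 0))) * F * (f n)⁻¹) hmin ?_ ?_
    · change F ((f n)⁻¹ 0) + -(F ((f n)⁻¹ 0)) = 0
      exact add_neg_cancel _
    · rw [conj_mul, conj_inv_eq_iff.2 rfl, conj_mul, hF]
      rfl
  have hlim : Tendsto (fun n => flow (-(F ((f n)⁻¹ 0))) (r φ').1) atTop (𝓝 (r φ').1) := by
    refine Tendsto.congr hval ?_
    refine ((continuous_subtype_val.comp hrc).tendsto φ').comp ?_
    exact tendsto_subtype_rng.2 hf
  have ht := (h4 _ ⟨hρIII, (r φ').2⟩ _ hlim).neg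
  have ht' := ((homeo0_continuous F⁻¹).tendsto _).comp ht
  refine ⟨0, Metric.isBounded_range_of_tendsto (x := F⁻¹ (-0)) _ (ht'.congr fun n => ?_)⟩
  rw [Function.comp_apply, neg_neg, homeo0_inv_apply_self]

theorem tendsto_zero_of_tendsto_translation {t : ℕ → ℝ}
    (h : Tendsto (fun n => translation (t n)) atTop (𝓝 1)) : Tendsto t atTop (𝓝 0) :=
  (tendsto_homeo0_iff.1 h 0).congr fun n => zero_add (t n)

end LineAction

/-! ### Assembly of the equivalences -/

open LineAction in
theorem mainTheorem2 (G : Type*) [Group G] [Countable G] :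
    List.TFAE [
      InClassC G,
      ∀ φ ∈ repIII G, ∀ f : ℕ → Homeo0, AlmostCentralizes f φ →
        Tendsto f atTop (𝓝 (1 : Homeo0)),
      ∀ φ ∈ repIII G, ∀ f : ℕ → Homeo0, AlmostCentralizes f φ →
        ∃ z : ℝ, Bornology.IsBounded (Set.range fun n : ℕ => (f n)⁻¹ z)] ∧
    (Group.FG G → ∀ H : Set (Act G), IsHarmonicSpace G H →
      (InClassC G ↔
        ∀ φ ∈ repIII G ∩ H, ∀ t : ℕ → ℝ,
          Tendsto (fun n : ℕ => flow (t n) φ) atTop (𝓝 φ) →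
            Tendsto t atTop (𝓝 0))) := by
  have h32 : (∀ φ ∈ repIII G, ∀ f : ℕ → Homeo0, AlmostCentralizes f φ →
      ∃ z : ℝ, Bornology.IsBounded (Set.range fun n : ℕ => (f n)⁻¹ z)) →
      ∀ φ ∈ repIII G, ∀ f : ℕ → Homeo0, AlmostCentralizes f φ → Tendsto f atTop (𝓝 1) :=
    fun h φ hφ => tendsto_one_of_bounded hφ (h φ hφ)
  have h21 : (∀ φ ∈ repIII G, ∀ f : ℕ → Homeo0, AlmostCentralizes f φ →
      Tendsto f atTop (𝓝 1)) → InClassC G := fun h =>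
    inClassC_of_separated fun φ hφ ψ hψ h1 h2 => by
      by_cases hp : IsProximal φ
      · exact mem_conjOrbit_of_eventually_bounded hφ hψ
          (eventually_bounded_of_almostCentralizes (h φ ⟨hφ, hp⟩)) h1 h2
      · exact mem_conjOrbit_of_not_isProximal hφ hψ hp h1
  have h13 : InClassC G → ∀ φ ∈ repIII G, ∀ f : ℕ → Homeo0, AlmostCentralizes f φ →
      ∃ z : ℝ, Bornology.IsBounded (Set.range fun n : ℕ => (f n)⁻¹ z) :=
    fun h φ hφ f hf => isBounded_of_inClassC h hφ hf
  refine ⟨?_, fun _ H hH => ⟨fun hC φ hφ t ht => ?_, fun h4 => h21 (h32 fun φ hφ f hf =>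
    isBounded_of_flow hH h4 hφ hf)⟩⟩
  · tfae_have 1 → 3 := h13
    tfae_have 3 → 2 := h32
    tfae_have 2 → 1 := h21
    tfae_finish
  · exact tendsto_zero_of_tendsto_translation (h32 (h13 hC) φ hφ.1 _ ht)
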